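/- Let $n>k\ge 0$ be integers with $k$ even and let $p\in[0,1]$. Place $n$ nodes on a ring; the ring distance of two nodes is the minimum number of hops between them. The $k$-connected ring lattice joins any two distinct nodes at ring distance at most $k/2$. The small-world network with added shortcuts $G_s$ is obtained from this lattice by adding each edge between two nodes that is not a lattice edge, independently with probability $p$. The capacity of a graph, possibly with edge weights, is its global minimum cut, i.e. the least total weight of the edges between the two sides of a partition of the node set into two nonempty parts (in an unweighted graph every edge has weight $1$). Let $c_w$ be the capacity of the weighted graph $G_w$ in which the weight of every edge is the probability that it is present in $G_s$. Theorem. If $n\ge 2$, then $c_w=k+(n-1-k)p$. Moreover, for every real $d>0$ there is a constant $C>0$ depending only on $d$ such that, for all $n,k,p$ as above with $k+(n-1-k)p>0$, setting $c_w=k+(n-1-k)p$ and $\epsilon=\sqrt{2(d+2)\ln(n)/c_w}$, the capacity $c_s$ of $G_s$ satisfies $$\Pr\big[(1-\epsilon)\,c_w\le c_s\le(1+\epsilon)\,c_w\big]\ \ge\ 1-\frac{C}{n^{d}} .$$ -/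

import Mathlib

open MeasureTheory ProbabilityTheory

namespace SmallWorld

/-- The ring distance between two of `n` nodes placed on a ring and numbered consecutively: the
minimum number of hops from one node to the other. -/
def ringDist {n : ℕ} (i j : Fin n) : ℕ :=
  min ((i : ℤ) - (j : ℤ)).natAbs (n - ((i : ℤ) - (j : ℤ)).natAbs)

/-- The `k`-connected ring lattice on `n` nodes: distinct nodes are joined if and only if their ring
distance is at most `k / 2`. -/
def ringLattice (n k : ℕ) : SimpleGraph (Fin n) where
  Adj i j := i ≠ j ∧ 2 * ringDist i j ≤ k
  symm := by
    constructor
    intro i j h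
    refine ⟨h.1.symm, ?_⟩
    have h2 := h.2
    unfold ringDist at h2 ⊢
    omega
  loopless := by
    constructor
    intro i h
    exact h.1 rfl

/-- The set of all edges between nodes that are not edges of the `k`-connected ring lattice. -/
def nonLatticeEdges (n k : ℕ) : Set (Sym2 (Fin n)) :=
  (⊤ : SimpleGraph (Fin n)).edgeSet \ (ringLattice n k).edgeSet

/-- The law of the small-world network with shortcuts: each non-lattice edge is added to the
`k`-connected ring lattice independently with probability `p`. -/
noncomputable def smallWorld (n k : ℕ) (p : unitInterval) : Measure (SimpleGraph (Fin n)) :=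
  (setBernoulli (nonLatticeEdges n k) p).map
    (fun F => ringLattice n k ⊔ SimpleGraph.fromEdgeSet F)

/-- The map that adds the random shortcuts is measurable. -/
theorem measurable_addShortcuts (n k : ℕ) :
    Measurable (fun F : Set (Sym2 (Fin n)) => ringLattice n k ⊔ SimpleGraph.fromEdgeSet F) :=
  Measurable.of_discrete

instance (n k : ℕ) (p : unitInterval) : IsProbabilityMeasure (smallWorld n k p) :=
  Measure.isProbabilityMeasure_map (measurable_addShortcuts n k).aemeasurable

/-- The value of the cut `(S, Sᶜ)` in the undirected graph with (symmetric) edge weights `w`. -/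
def cutValue {V : Type*} [Fintype V] [DecidableEq V] (w : V → V → ℝ) (S : Finset V) : ℝ :=
  ∑ i ∈ S, ∑ j ∈ Sᶜ, w i j

/-- The global minimum cut (the max-flow min-cut capacity) of the graph with edge weights `w`: the
least value of a cut `(S, Sᶜ)` both of whose sides are nonempty. -/
noncomputable def weightedCapacity {V : Type*} [Fintype V] [DecidableEq V] (w : V → V → ℝ) : ℝ :=
  sInf {x : ℝ | ∃ S : Finset V, S.Nonempty ∧ Sᶜ.Nonempty ∧ x = cutValue w S}

open Classical in
/-- The capacity of a simple graph: its global minimum cut, every edge having weight one. -/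
noncomputable def capacity {V : Type*} [Fintype V] [DecidableEq V] (G : SimpleGraph V) : ℝ :=
  weightedCapacity (fun i j => if G.Adj i j then (1 : ℝ) else 0)

/-- The edge weights of the weighted graph associated with the small-world network with shortcuts:
the weight of an edge is the probability that it is present in the network. -/
noncomputable def edgeProb (n k : ℕ) (p : unitInterval) (i j : Fin n) : ℝ :=
  (smallWorld n k p).real {G | G.Adj i j}

/-- The number `c_w = k + (n - 1 - k) p`. -/
noncomputable def cw (n k : ℕ) (p : unitInterval) : ℝ :=
  (k : ℝ) + ((n : ℝ) - 1 - (k : ℝ)) * (p : ℝ)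

/-- The number `ε = √(2 (d + 2) ln n / c_w)`. -/
noncomputable def eps (d : ℝ) (n k : ℕ) (p : unitInterval) : ℝ :=
  Real.sqrt (2 * (d + 2) * Real.log (n : ℝ) / cw n k p)

end SmallWorld

namespace SmallWorld

/-! The weighted graph is circulant, so a cut is governed by the numbers N_h(S) of elements of S
that translation by h moves out of S. With k = 2r, its value is (1 - p) · 2(N_1 + ... + N_r) + p ·
|S| · |Sᶜ|. Since N_1 + ... + N_r ≥ r (`le_sum_crossCount`) and |S| · |Sᶜ| ≥ n - 1, it is at least
c_w, with equality at singletons.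

Lower tail: a Chernoff bound for each cut (`measure_cut_lt_le`) and a union bound over all cuts.
Cuts of value w fail with probability at most exp(-(d + 2) ln(n) w / c_w), so it remains to bound
the partition function ∑ exp(-2 ln(n) w(S) / c_w) by a constant (`sum_exp_neg_log_cutValue_le`). To
this end 2w / c_w is bounded below by the average, over rotations of the ring, of an energy in which
each node after the first distributes unit weight over its predecessors. Such an energy can be
summed node by node: putting a node on one side or the other costs x or 1 - x with x ∈ [0, 1], so
each new node contributes a factor of at most 1 + e^{-l} (`sum_powerset_exp_backwardEnergy_le`).
Jensen's inequality transfers this to the cut values.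

Upper tail: the capacity is at most the minimum degree, hence at most the average degree, so a large
capacity forces a large total number of edges. One Chernoff bound for that number suffices
(`measure_lt_capacity_le`). -/

/-! ### Exponential moments of edge counts. -/

theorem integral_prod_setBernoulli {ι : Type*} [Fintype ι] (u : Set ι) (p : unitInterval)
    (f : ι → Prop → ℝ) :
    ∫ F, ∏ e, f e (e ∈ F) ∂(setBernoulli u p) =
      ∏ e, ((p : ℝ) * f e (e ∈ u) + (1 - (p : ℝ)) * f e False) := by
  rw [setBernoulli_eq_map, integral_map (by fun_prop) (by
    exact Measurable.aestronglyMeasurable (by fun_prop))]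
  simp only [Set.mem_ofPred_eq]
  rw [Measure.infinitePi_eq_pi,
    integral_fintype_prod_eq_prod (fun e (P : Prop) => f e P)]
  refine Finset.prod_congr rfl fun e _ => ?_
  rw [integral_add_measure]
  · simp [integral_smul_nnreal_measure, NNReal.smul_def]
  · exact (integrable_dirac (by simp)).smul_measure (by simp)
  · exact (integrable_dirac (by simp)).smul_measure (by simp)

open Classical in
/-- The probability that an unordered pair of distinct nodes is an edge of the random network. -/
noncomputable def pairWeight (n k : ℕ) (p : unitInterval) (e : Sym2 (Fin n)) : ℝ :=
  if e ∈ (ringLattice n k).edgeSet then 1 else (p : ℝ)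

open Classical in
/-- The indicator of an edge of the graph `G`. -/
noncomputable def edgeInd {V : Type*} (G : SimpleGraph V) (e : Sym2 V) : ℝ :=
  if e ∈ G.edgeSet then 1 else 0

instance discreteMeasurableSpace_simpleGraph {V : Type*} [Finite V] :
    DiscreteMeasurableSpace (SimpleGraph V) where
  forall_measurableSet s := by
    rw [← SimpleGraph.measurableEmbedding_edgeSet.measurableSet_image]
    exact .of_discrete

theorem measurable_smallWorld_fun {V β : Type*} [Finite V] [MeasurableSpace β]
    (f : SimpleGraph V → β) : Measurable f := Measurable.of_discrete

/-- Independence factorizes the moment generating function. Lattice edges fit the same formula with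
weight 1. Diagonal pairs are excluded because they are never edges, whereas `pairWeight` gives them
weight `p`. -/
theorem integral_exp_edgeInd (n k : ℕ) (p : unitInterval) (B : Finset (Sym2 (Fin n)))
    (hB : ∀ e ∈ B, ¬ e.IsDiag) (θ : ℝ) :
    ∫ G, Real.exp (θ * ∑ e ∈ B, edgeInd G e) ∂(smallWorld n k p) =
      ∏ e ∈ B, (1 + pairWeight n k p e * (Real.exp θ - 1)) := by
  classical
  rw [smallWorld, integral_map (measurable_addShortcuts n k).aemeasurable
    (measurable_smallWorld_fun _).aestronglyMeasurable]
  have h := integral_prod_setBernoulli (nonLatticeEdges n k) p (fun e P =>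
    if e ∈ B then Real.exp (θ * (if e ∈ (ringLattice n k).edgeSet ∨ P then 1 else 0)) else 1)
  have h1 : ∀ F : Set (Sym2 (Fin n)),
      Real.exp (θ * ∑ e ∈ B, edgeInd (ringLattice n k ⊔ SimpleGraph.fromEdgeSet F) e) =
      ∏ e, (if e ∈ B then
        Real.exp (θ * (if e ∈ (ringLattice n k).edgeSet ∨ e ∈ F then 1 else 0)) else 1) := by
    intro F
    rw [Finset.prod_ite_mem, Finset.univ_inter, Finset.mul_sum, Real.exp_sum]
    refine Finset.prod_congr rfl fun e he => ?_
    have := hB e he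
    simp [edgeInd, this]
  simp_rw [h1]
  rw [h, ← Finset.prod_subset (Finset.subset_univ B)]
  · refine Finset.prod_congr rfl fun e he => ?_
    have hd := hB e he
    by_cases hl : e ∈ (ringLattice n k).edgeSet
    · simp [he, hl, pairWeight]
      ring
    · simp [he, hl, pairWeight, nonLatticeEdges, hd]
      ring
  · intro e _ he
    simp [he]

theorem pairWeight_nonneg (n k : ℕ) (p : unitInterval) (e : Sym2 (Fin n)) :
    0 ≤ pairWeight n k p e := by
  unfold pairWeight
  split_ifs
  · exact zero_le_one
  · exact p.2.1

theorem integral_exp_edgeInd_le (n k : ℕ) (p : unitInterval) (B : Finset (Sym2 (Fin n)))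
    (hB : ∀ e ∈ B, ¬ e.IsDiag) (θ : ℝ) :
    ∫ G, Real.exp (θ * ∑ e ∈ B, edgeInd G e) ∂(smallWorld n k p) ≤
      Real.exp ((Real.exp θ - 1) * ∑ e ∈ B, pairWeight n k p e) := by
  rw [integral_exp_edgeInd n k p B hB, Finset.mul_sum, Real.exp_sum]
  refine Finset.prod_le_prod (fun e _ => ?_) fun e _ => ?_
  · have h1 : pairWeight n k p e ≤ 1 := by
      unfold pairWeight
      split_ifs
      · exact le_rfl
      · exact p.2.2
    nlinarith [pairWeight_nonneg n k p e, Real.exp_pos θ]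
  · linarith [Real.add_one_le_exp ((Real.exp θ - 1) * pairWeight n k p e)]

theorem measure_exp_markov (n k : ℕ) (p : unitInterval) (B : Finset (Sym2 (Fin n)))
    (hB : ∀ e ∈ B, ¬ e.IsDiag) (θ a : ℝ) :
    (smallWorld n k p).real {G | a ≤ θ * ∑ e ∈ B, edgeInd G e} ≤
      Real.exp ((Real.exp θ - 1) * ∑ e ∈ B, pairWeight n k p e - a) := by
  have h := mul_meas_ge_le_integral_of_nonneg (μ := smallWorld n k p)
    (f := fun G => Real.exp (θ * ∑ e ∈ B, edgeInd G e))
    (Filter.Eventually.of_forall fun _ => (Real.exp_pos _).le) .of_finite (Real.exp a)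
  simp only [Real.exp_le_exp] at h
  rw [Real.exp_sub, le_div_iff₀ (Real.exp_pos a), mul_comm]
  exact h.trans (integral_exp_edgeInd_le n k p B hB θ)

/-- Read off from the moment generating function of a single indicator at θ = 1, after cancelling e
- 1 ≠ 0. -/
theorem edgeProb_eq_pairWeight (n k : ℕ) (p : unitInterval) {i j : Fin n} (hij : i ≠ j) :
    edgeProb n k p i j = pairWeight n k p s(i, j) := by
  classical
  have h := integral_exp_edgeInd n k p {s(i, j)} (by simpa using hij) 1
  have h2 : ∀ G : SimpleGraph (Fin n), Real.exp (1 * ∑ e ∈ {s(i, j)}, edgeInd G e) =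
      1 + {G : SimpleGraph (Fin n) | G.Adj i j}.indicator (fun _ => Real.exp 1 - 1) G := by
    intro G
    by_cases hG : G.Adj i j <;>
      simp [edgeInd, hG, Finset.filter_singleton]
  simp_rw [h2] at h
  rw [integral_add .of_finite .of_finite, integral_indicator_const _ .of_discrete] at h
  simp only [integral_const, probReal_univ, Finset.prod_singleton, smul_eq_mul, mul_one] at h
  have he : Real.exp 1 - 1 ≠ 0 := by
    have := Real.add_one_lt_exp (x := 1) one_ne_zero
    linarith
  exact mul_right_cancel₀ he (by unfold edgeProb; linarith)

theorem edgeProb_self (n k : ℕ) (p : unitInterval) (i : Fin n) : edgeProb n k p i i = 0 := by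
  simp [edgeProb]

/-! ### Cuts of circulant graphs and the value of c_w. -/

section Circulant

open scoped Fin.CommRing

theorem ringDist_eq {n : ℕ} {i j : Fin n} (hij : i ≠ j) :
    ringDist i j = min (j - i).val (n - (j - i).val) := by
  have hi := i.isLt
  have hj := j.isLt
  have hne : (i : ℕ) ≠ j := fun h => hij (Fin.ext h)
  unfold ringDist
  rw [Fin.val_sub]
  rcases lt_or_gt_of_ne hne with h | h
  · have : (n - i.val + j.val) % n = j - i := by
      rw [show n - i.val + j.val = (j - i) + n by omega, Nat.add_mod_right,
        Nat.mod_eq_of_lt (by omega)]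
    omega
  · rw [Nat.mod_eq_of_lt (a := n - i.val + j.val) (by omega)]
    omega

variable {n : ℕ} [NeZero n]

/-- The number of elements `i` of `S` whose translate `i + h` lies outside `S`. -/
def crossCount (S : Finset (Fin n)) (h : Fin n) : ℕ := (S.filter fun i => i + h ∉ S).card

theorem crossCount_zero (S : Finset (Fin n)) : crossCount S 0 = 0 := by
  simp [crossCount]

/-- Translation by `h` matches the elements of `S` whose translate by `-h` stays in `S` with those
whose translate by `h` does; take complements in `S`. -/
theorem crossCount_neg (S : Finset (Fin n)) (h : Fin n) :
    crossCount S (-h) = crossCount S h := by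
  have key : (S.filter fun i => i + -h ∈ S).card = (S.filter fun i => i + h ∈ S).card := by
    refine Finset.card_bij' (fun i _ => i + -h) (fun i _ => i + h) ?_ ?_ ?_ ?_ <;>
      simp +contextual
  have h1 := Finset.card_filter_add_card_filter_not (s := S) (fun i => i + -h ∈ S)
  have h2 := Finset.card_filter_add_card_filter_not (s := S) (fun i => i + h ∈ S)
  unfold crossCount
  omega

theorem cutValue_circulant (ω : Fin n → ℝ) (S : Finset (Fin n)) :
    cutValue (fun i j => ω (j - i)) S = ∑ h, ω h * crossCount S h := by
  have h1 : ∀ i, ∑ j ∈ Sᶜ, ω (j - i) = ∑ h, if i + h ∉ S then ω h else 0 := by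
    intro i
    rw [← Equiv.sum_comp (Equiv.subRight i)]
    simp only [Equiv.subRight_apply, add_sub_cancel]
    rw [← Finset.sum_filter]
    refine Finset.sum_congr ?_ fun _ _ => rfl
    ext j
    simp
  simp only [cutValue, h1]
  rw [Finset.sum_comm]
  refine Finset.sum_congr rfl fun h _ => ?_
  rw [← Finset.sum_filter, Finset.sum_const, nsmul_eq_mul, mul_comm]
  rfl

theorem sum_crossCount (S : Finset (Fin n)) : ∑ h, crossCount S h = S.card * Sᶜ.card := by
  have h := cutValue_circulant (fun _ => 1) S
  simp only [cutValue, Finset.sum_const, nsmul_eq_mul, mul_one, one_mul] at h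
  exact_mod_cast h.symm

theorem eq_univ_of_forall_add_one_mem {S : Finset (Fin n)} (hS : S.Nonempty)
    (h : ∀ i ∈ S, i + 1 ∈ S) : S = Finset.univ := by
  obtain ⟨i, hi⟩ := hS
  have key : ∀ m : ℕ, i + (m : Fin n) ∈ S := by
    intro m
    induction m with
    | zero => simpa using hi
    | succ m ih =>
      have := h _ ih
      rwa [add_assoc, ← Nat.cast_succ] at this
  refine Finset.eq_univ_of_forall fun j => ?_
  have := key (j - i).val
  rwa [Fin.cast_val_eq_self, add_sub_cancel] at this

theorem crossCount_one_pos {S : Finset (Fin n)} (hS : S.Nonempty) (hSc : Sᶜ.Nonempty) :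
    0 < crossCount S 1 := by
  rw [crossCount, Finset.card_pos]
  by_contra hne
  rw [Finset.not_nonempty_iff_eq_empty, Finset.filter_eq_empty_iff] at hne
  have := eq_univ_of_forall_add_one_mem hS fun i hi => not_not.1 (hne hi)
  simp [this] at hSc

/-- Here `S` is invariant under translation by `a`, so translating by `a - 1` leaves `S` exactly
when translating by `-1` does. Some `i` has this property, and by invariance so does `i + a ≠ i`. -/
theorem two_le_crossCount_sub_one {S : Finset (Fin n)} (hS : S.Nonempty) (hSc : Sᶜ.Nonempty)
    {a : Fin n} (ha : a ≠ 0) (h0 : crossCount S a = 0) : 2 ≤ crossCount S (a - 1) := by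
  rw [crossCount, Finset.card_eq_zero, Finset.filter_eq_empty_iff] at h0
  have hadd : ∀ i ∈ S, i + a ∈ S := fun i hi => not_not.1 (h0 hi)
  have hsurj : ∀ i, i + a ∈ S → i ∈ S := by
    have himg : S.image (fun i => i + a) = S := by
      refine Finset.eq_of_subset_of_card_le ?_ ?_
      · intro x hx
        obtain ⟨i, hi, rfl⟩ := Finset.mem_image.1 hx
        exact hadd i hi
      · rw [Finset.card_image_of_injective _ (add_left_injective a)]
    intro i hi
    rw [← himg] at hi
    obtain ⟨j, hj, hji⟩ := Finset.mem_image.1 hi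
    rwa [← add_left_injective a hji]
  have hpos : 0 < crossCount S (-1) := by
    rw [crossCount_neg]
    exact crossCount_one_pos hS hSc
  rw [crossCount, Finset.card_pos] at hpos
  obtain ⟨i, hi⟩ := hpos
  rw [Finset.mem_filter] at hi
  refine Finset.one_lt_card.2 ⟨i, ?_, i + a, ?_, by simpa using ha⟩
  · refine Finset.mem_filter.2 ⟨hi.1, fun hmem => hi.2 (hsurj _ ?_)⟩
    convert hmem using 1
    ring
  · refine Finset.mem_filter.2 ⟨hadd _ hi.1, fun hmem => hi.2 (hsurj _ (hsurj _ ?_))⟩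
    convert hmem using 1
    ring

theorem natCast_ne_zero_of_lt {m : ℕ} (h0 : 0 < m) (hm : m < n) : (m : Fin n) ≠ 0 := by
  intro h
  rw [Fin.natCast_eq_zero] at h
  exact absurd (Nat.le_of_dvd h0 h) (not_le.2 hm)

/-- Two-step induction: a positive last term gains 1 over the sum with one term fewer; if it
vanishes, the term before it is at least 2, which pays for both. -/
theorem le_sum_crossCount {S : Finset (Fin n)} (hS : S.Nonempty) (hSc : Sᶜ.Nonempty) :
    ∀ r : ℕ, r < n → r ≤ ∑ h ∈ Finset.range r, crossCount S ((h + 1 : ℕ) : Fin n)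
  | 0, _ => by simp
  | 1, _ => by
    simpa using Nat.succ_le_of_lt (crossCount_one_pos hS hSc)
  | r + 2, hr => by
    have ih1 := le_sum_crossCount hS hSc (r + 1) (by omega)
    have ih2 := le_sum_crossCount hS hSc r (by omega)
    rw [Finset.sum_range_succ]
    rcases Nat.eq_zero_or_pos (crossCount S ((r + 1 + 1 : ℕ) : Fin n)) with h0 | h0
    · have h2 := two_le_crossCount_sub_one hS hSc
        (natCast_ne_zero_of_lt (Nat.succ_pos _) hr) h0
      rw [Nat.cast_succ (r + 1), add_sub_cancel_right] at h2
      rw [Finset.sum_range_succ]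
      omega
    · omega

/-- The weight of the pair `{i, i + h}` in the weighted graph of the small-world network. -/
noncomputable def ringWeight (k : ℕ) (p : unitInterval) (h : Fin n) : ℝ :=
  if h = 0 then 0 else if 2 * min h.val (n - h.val) ≤ k then 1 else (p : ℝ)

theorem edgeProb_eq_ringWeight (k : ℕ) (p : unitInterval) (i j : Fin n) :
    edgeProb n k p i j = ringWeight k p (j - i) := by
  rcases eq_or_ne i j with rfl | hij
  · simp [edgeProb_self, ringWeight]
  · rw [edgeProb_eq_pairWeight n k p hij, pairWeight, ringWeight,
      if_neg (sub_ne_zero.2 hij.symm), ← ringDist_eq hij]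
    simp [ringLattice, hij]

/-- The lattice steps are ±1, ..., ±r, pairwise distinct because 2r < n, and opposite steps have
equal counts. -/
theorem sum_lattice_crossCount {r : ℕ} (hr : 2 * r < n) (S : Finset (Fin n)) :
    ∑ h : Fin n, (if h ≠ 0 ∧ 2 * min h.val (n - h.val) ≤ 2 * r then crossCount S h else 0) =
      2 * ∑ h ∈ Finset.range r, crossCount S ((h + 1 : ℕ) : Fin n) := by
  have h1 : ∀ h : Fin n, (if h ≠ 0 ∧ 2 * min h.val (n - h.val) ≤ 2 * r then crossCount S h else 0) =
      (fun m : ℕ => if m ≠ 0 ∧ (m ≤ r ∨ n - m ≤ r) then crossCount S (m : Fin n) else 0) h.val := by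
    intro h
    simp only [Fin.cast_val_eq_self]
    refine if_congr ?_ rfl rfl
    rw [← Fin.val_ne_zero_iff]
    omega
  rw [Finset.sum_congr rfl fun h _ => h1 h, Fin.sum_univ_eq_sum_range
    (fun m : ℕ => if m ≠ 0 ∧ (m ≤ r ∨ n - m ≤ r) then crossCount S (m : Fin n) else 0), ← Finset.sum_filter]
  have h2 : (Finset.range n).filter (fun m => m ≠ 0 ∧ (m ≤ r ∨ n - m ≤ r)) =
      (Finset.range r).image (fun h => h + 1) ∪ (Finset.range r).image (fun h => n - (h + 1)) := by
    ext m
    simp only [Finset.mem_filter, Finset.mem_range, Finset.mem_union, Finset.mem_image]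
    constructor
    · rintro ⟨hm, h0, h | h⟩
      · exact Or.inl ⟨m - 1, by omega, by omega⟩
      · exact Or.inr ⟨n - m - 1, by omega, by omega⟩
    · rintro (⟨a, ha, rfl⟩ | ⟨a, ha, rfl⟩) <;> omega
  rw [h2, Finset.sum_union, Finset.sum_image, Finset.sum_image, two_mul]
  · congr 1
    refine Finset.sum_congr rfl fun h hh => ?_
    rw [Finset.mem_range] at hh
    rw [← crossCount_neg S ((h + 1 : ℕ) : Fin n), Nat.cast_sub (by omega), Fin.natCast_self,
      zero_sub]
  · intro a ha b hb hab
    simp only [Finset.coe_range, Set.mem_Iio] at ha hb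
    dsimp only at hab
    omega
  · intro a _ b _ hab
    simpa using hab
  · rw [Finset.disjoint_left]
    intro m hm hm'
    simp only [Finset.mem_image, Finset.mem_range] at hm hm'
    omega

theorem cutValue_edgeProb {r : ℕ} (hr : 2 * r < n) (p : unitInterval) (S : Finset (Fin n)) :
    cutValue (edgeProb n (2 * r) p) S =
      (1 - (p : ℝ)) * (2 * ∑ h ∈ Finset.range r, (crossCount S ((h + 1 : ℕ) : Fin n) : ℝ)) +
        p * (S.card * Sᶜ.card) := by
  have h0 : edgeProb n (2 * r) p = fun i j => ringWeight (2 * r) p (j - i) := by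
    funext i j
    exact edgeProb_eq_ringWeight _ p i j
  have h1 : ∀ h : Fin n, ringWeight (2 * r) p h * crossCount S h =
      (1 - (p : ℝ)) * ((if h ≠ 0 ∧ 2 * min h.val (n - h.val) ≤ 2 * r then crossCount S h else 0 : ℕ)
        : ℝ) + p * crossCount S h := by
    intro h
    unfold ringWeight
    by_cases hz : h = 0
    · simp [hz, crossCount_zero]
    · by_cases hl : 2 * min h.val (n - h.val) ≤ 2 * r
      · rw [if_neg hz, if_pos hl, if_pos ⟨hz, hl⟩]
        ring
      · rw [if_neg hz, if_neg hl, if_neg (fun h => hl h.2)]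
        simp
  rw [h0, cutValue_circulant, Finset.sum_congr rfl fun h _ => h1 h, Finset.sum_add_distrib,
    ← Finset.mul_sum, ← Finset.mul_sum]
  have h2 := sum_lattice_crossCount hr S
  have h3 := sum_crossCount S
  rw [← Nat.cast_sum, ← Nat.cast_sum, h2, h3]
  push_cast
  ring

/-- Both c_w and the cut value are combinations with coefficients 1 - p and p, so the bounds r ≤ N_1
+ ... + N_r and n - 1 ≤ |S| · |Sᶜ| are applied termwise. -/
theorem cw_le_cutValue {r : ℕ} (hr : 2 * r < n) (p : unitInterval) {S : Finset (Fin n)}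
    (hS : S.Nonempty) (hSc : Sᶜ.Nonempty) :
    cw n (2 * r) p ≤ cutValue (edgeProb n (2 * r) p) S := by
  rw [cutValue_edgeProb hr, cw]
  have h1 : (r : ℝ) ≤ ∑ h ∈ Finset.range r, (crossCount S ((h + 1 : ℕ) : Fin n) : ℝ) := by
    exact_mod_cast le_sum_crossCount hS hSc r (by omega)
  have hs : (1 : ℝ) ≤ S.card := by exact_mod_cast hS.card_pos
  have hsc : (1 : ℝ) ≤ Sᶜ.card := by exact_mod_cast hSc.card_pos
  have hn : (S.card : ℝ) + Sᶜ.card = n := by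
    have := S.card_add_card_compl
    rw [Fintype.card_fin] at this
    exact_mod_cast this
  have h2 : (n : ℝ) - 1 ≤ S.card * Sᶜ.card := by nlinarith
  have hp1 : 0 ≤ 1 - (p : ℝ) := sub_nonneg.2 p.2.2
  have h3 := mul_le_mul_of_nonneg_left h1 hp1
  have h4 := mul_le_mul_of_nonneg_left h2 p.2.1
  rw [Nat.cast_mul, Nat.cast_ofNat]
  linarith

theorem crossCount_singleton (v : Fin n) {h : Fin n} (hh : h ≠ 0) : crossCount {v} h = 1 := by
  simp [crossCount, hh, Finset.filter_singleton]

theorem cutValue_edgeProb_singleton {r : ℕ} (hr : 2 * r < n) (p : unitInterval) (v : Fin n) :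
    cutValue (edgeProb n (2 * r) p) {v} = cw n (2 * r) p := by
  rw [cutValue_edgeProb hr, cw, Finset.sum_congr rfl (g := fun _ => (1 : ℝ))]
  · rw [Finset.card_compl, Finset.card_singleton, Fintype.card_fin, Nat.cast_sub (NeZero.pos n)]
    simp
    ring
  · intro h hh
    rw [Finset.mem_range] at hh
    rw [crossCount_singleton v (natCast_ne_zero_of_lt (Nat.succ_pos h) (by omega)), Nat.cast_one]

end Circulant

theorem weightedCapacity_edgeProb (n k : ℕ) (p : unitInterval) (hn : 2 ≤ n) (hk : Even k)
    (hkn : k < n) : weightedCapacity (edgeProb n k p) = cw n k p := by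
  have : NeZero n := ⟨by omega⟩
  obtain ⟨r, rfl⟩ := hk.exists_two_nsmul
  rw [smul_eq_mul] at hkn ⊢
  refine IsLeast.csInf_eq ⟨⟨{0}, Finset.singleton_nonempty _, ?_, ?_⟩, ?_⟩
  · rw [← Finset.card_pos, Finset.card_compl, Finset.card_singleton, Fintype.card_fin]
    omega
  · exact (cutValue_edgeProb_singleton hkn p 0).symm
  · rintro x ⟨S, hS, hSc, rfl⟩
    exact cw_le_cutValue hkn p hS hSc

/-! ### A partition function summed node by node. -/

open Classical in
/-- The indicator that exactly one of `a` and `b` lies in `S`. -/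
noncomputable def separates {V : Type*} (S : Finset V) (a b : V) : ℝ :=
  if a ∈ S ↔ b ∈ S then 0 else 1

/-- The number of separated pairs `(i, i - 1 - h)` with `h < i < m`, weighted by `B i h`. -/
noncomputable def backwardEnergy (B : ℕ → ℕ → ℝ) (m : ℕ) (S : Finset ℕ) : ℝ :=
  ∑ i ∈ Finset.range m, ∑ h ∈ Finset.range i, B i h * separates S i (i - 1 - h)

/-- The two exponentials a, b ≤ 1 have product exp(-l), so this is (1 - a)(1 - b) ≥ 0. -/
theorem exp_neg_add_exp_neg_le {l x : ℝ} (hl : 0 ≤ l) (hx0 : 0 ≤ x) (hx1 : x ≤ 1) :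
    Real.exp (-(l * x)) + Real.exp (-(l * (1 - x))) ≤ 1 + Real.exp (-l) := by
  have h1 : Real.exp (-(l * x)) ≤ 1 := Real.exp_le_one_iff.2 (by nlinarith)
  have h2 : Real.exp (-(l * (1 - x))) ≤ 1 := Real.exp_le_one_iff.2 (by nlinarith)
  have h3 : Real.exp (-l) = Real.exp (-(l * x)) * Real.exp (-(l * (1 - x))) := by
    rw [← Real.exp_add]
    ring_nf
  rw [h3]
  nlinarith

/-- The last node interacts only with earlier ones, with total weight 1. If leaving it out of `S`
adds energy x, inserting it adds 1 - x, and summing over the two choices gives the factor 1 +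
e^{-l}. The initial 2 is the free choice for node 0. -/
theorem sum_powerset_exp_backwardEnergy_le {B : ℕ → ℕ → ℝ} (hB0 : ∀ i h, 0 ≤ B i h)
    (hB1 : ∀ i, 1 ≤ i → ∑ h ∈ Finset.range i, B i h = 1) {l : ℝ} (hl : 0 ≤ l) (m : ℕ) :
    ∑ S ∈ (Finset.range (m + 1)).powerset, Real.exp (-(l * backwardEnergy B (m + 1) S)) ≤
      2 * (1 + Real.exp (-l)) ^ m := by
  induction m with
  | zero =>
    simp [backwardEnergy, Finset.card_powerset]
  | succ m ih =>
    rw [Finset.range_add_one (n := m + 1), Finset.sum_powerset_insert (by simp),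
      ← Finset.sum_add_distrib, pow_succ, ← mul_assoc]
    refine le_trans ?_ (mul_le_mul_of_nonneg_right ih (by positivity))
    rw [Finset.sum_mul]
    refine Finset.sum_le_sum fun S hS => ?_
    rw [Finset.mem_powerset] at hS
    have hm : m + 1 ∉ S := fun h => by simpa using hS h
    set x := ∑ h ∈ Finset.range (m + 1), B (m + 1) h * separates S (m + 1) (m + 1 - 1 - h) with hx
    have hle : ∀ i j, separates S i j ≤ 1 := fun i j => by unfold separates; split_ifs <;> norm_num
    have hge : ∀ i j, 0 ≤ separates S i j := fun i j => by unfold separates; split_ifs <;> norm_num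
    have hx0 : 0 ≤ x := Finset.sum_nonneg fun h _ => mul_nonneg (hB0 _ _) (hge _ _)
    have hx1 : x ≤ 1 := by
      rw [← hB1 (m + 1) (by omega), hx]
      exact Finset.sum_le_sum fun h _ => mul_le_of_le_one_right (hB0 _ _) (hle _ _)
    have e1 : backwardEnergy B (m + 1 + 1) S = backwardEnergy B (m + 1) S + x := by
      rw [backwardEnergy, Finset.sum_range_succ, backwardEnergy]
    have e2 : backwardEnergy B (m + 1 + 1) (insert (m + 1) S) =
        backwardEnergy B (m + 1) S + (1 - x) := by
      rw [backwardEnergy, Finset.sum_range_succ, backwardEnergy]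
      congr 1
      · refine Finset.sum_congr rfl fun i hi => Finset.sum_congr rfl fun h hh => ?_
        rw [Finset.mem_range] at hi hh
        have h1 : i ≠ m + 1 := by omega
        have h2 : i - 1 - h ≠ m + 1 := by omega
        simp [separates, h1, h2]
      · rw [← hB1 (m + 1) (by omega), hx, ← Finset.sum_sub_distrib]
        refine Finset.sum_congr rfl fun h hh => ?_
        have h2 : m - h ≠ m + 1 := by omega
        by_cases hs : m - h ∈ S <;> simp [separates, h2, hm, hs]
    have key := mul_le_mul_of_nonneg_left (exp_neg_add_exp_neg_le hl hx0 hx1)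
      (Real.exp_pos (-(l * backwardEnergy B (m + 1) S))).le
    rw [e1, e2]
    calc _ = Real.exp (-(l * backwardEnergy B (m + 1) S)) *
          (Real.exp (-(l * x)) + Real.exp (-(l * (1 - x)))) := by
            rw [mul_add (Real.exp _), ← Real.exp_add, ← Real.exp_add]
            ring_nf
      _ ≤ _ := key

/-! ### Averaging over rotations of the ring. -/

section Rotation

open scoped Fin.CommRing

variable {n : ℕ} [NeZero n]

/-- The labels of the elements of `S` when the ring is numbered starting at the node `b`. -/
def rotate (b : Fin n) (S : Finset (Fin n)) : Finset ℕ :=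
  (Finset.univ.filter fun i : Fin n => i + b ∈ S).map Fin.valEmbedding

theorem mem_rotate {b : Fin n} {S : Finset (Fin n)} {i : ℕ} (hi : i < n) :
    i ∈ rotate b S ↔ (i : Fin n) + b ∈ S := by
  simp only [rotate, Finset.mem_map, Finset.mem_filter, Finset.mem_univ, true_and,
    Fin.valEmbedding_apply]
  constructor
  · rintro ⟨a, ha, rfl⟩
    rwa [Fin.cast_val_eq_self]
  · intro h
    exact ⟨(i : Fin n), h, Fin.val_cast_of_lt hi⟩

theorem sum_rotate (b : Fin n) (f : Finset ℕ → ℝ) :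
    ∑ S : Finset (Fin n), f (rotate b S) = ∑ T ∈ (Finset.range n).powerset, f T := by
  have hsub : ∀ S, rotate b S ⊆ Finset.range n := by
    intro S x hx
    simp only [rotate, Finset.mem_map, Fin.valEmbedding_apply] at hx
    obtain ⟨a, -, rfl⟩ := hx
    simp
  refine Finset.sum_bij' (fun S _ => rotate b S)
    (fun T _ => Finset.univ.filter fun x : Fin n => (x - b).val ∈ T) ?_ ?_ ?_ ?_ ?_
  · intro S _
    exact Finset.mem_powerset.2 (hsub S)
  · intro T _
    exact Finset.mem_univ _
  · intro S _
    ext x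
    simp [mem_rotate (x - b).isLt]
  · intro T hT
    rw [Finset.mem_powerset] at hT
    ext i
    constructor
    · intro hi
      have hin := Finset.mem_range.1 (hsub _ hi)
      rw [mem_rotate hin] at hi
      simpa [Nat.mod_eq_of_lt hin] using hi
    · intro hi
      have hin := Finset.mem_range.1 (hT hi)
      rw [mem_rotate hin]
      simpa [Nat.mod_eq_of_lt hin] using hi
  · intro S _
    rfl

/-- As `b` runs through the ring, the pair runs through all pairs (x, x + d) with d = h + 1. It is
separated when x + d leaves `S` starting from x, or x leaves `S` starting from x + d; these cases
are counted by d and -d respectively. -/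
theorem sum_separates_rotate (S : Finset (Fin n)) {i h : ℕ} (hi : i < n) (hh : h < i) :
    ∑ b, separates (rotate b S) i (i - 1 - h) = 2 * crossCount S ((h + 1 : ℕ) : Fin n) := by
  have hj : ((i : ℕ) : Fin n) = ((i - 1 - h : ℕ) : Fin n) + ((h + 1 : ℕ) : Fin n) := by
    rw [← Nat.cast_add]
    congr 1
    omega
  set d : Fin n := ((h + 1 : ℕ) : Fin n)
  have h1 : ∀ b : Fin n, separates (rotate b S) i (i - 1 - h) =
      (fun x : Fin n => (if x ∈ S ∧ x + d ∉ S then (1 : ℝ) else 0)) (b + (i - 1 - h : ℕ)) +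
      (fun x : Fin n => (if x ∈ S ∧ x + -d ∉ S then (1 : ℝ) else 0)) (b + (i : ℕ)) := by
    intro b
    have e1 : b + ((i - 1 - h : ℕ) : Fin n) + d = i + b := by rw [hj]; ring
    have e2 : b + ((i : ℕ) : Fin n) + -d = (i - 1 - h : ℕ) + b := by rw [hj]; ring
    simp only [separates, mem_rotate hi, mem_rotate (show i - 1 - h < n by omega), e1, e2]
    rw [add_comm b, add_comm b]
    by_cases ha : ((i : ℕ) : Fin n) + b ∈ S <;>
      by_cases hb : ((i - 1 - h : ℕ) : Fin n) + b ∈ S <;> simp [ha, hb]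
  have h2 : ∀ e c : Fin n,
      ∑ b, (fun x : Fin n => (if x ∈ S ∧ x + e ∉ S then (1 : ℝ) else 0)) (b + c) =
        crossCount S e := by
    intro e c
    refine (Equiv.sum_comp (Equiv.addRight c)
      (fun x : Fin n => (if x ∈ S ∧ x + e ∉ S then (1 : ℝ) else 0))).trans ?_
    rw [Finset.sum_boole, crossCount]
    congr 2
    ext x
    simp
  rw [Finset.sum_congr rfl fun b _ => h1 b, Finset.sum_add_distrib, h2, h2, crossCount_neg]
  ring

theorem sum_backwardEnergy_rotate (B : ℕ → ℕ → ℝ) (S : Finset (Fin n)) :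
    ∑ b, backwardEnergy B n (rotate b S) =
      2 * ∑ i ∈ Finset.range n, ∑ h ∈ Finset.range i,
        B i h * crossCount S ((h + 1 : ℕ) : Fin n) := by
  unfold backwardEnergy
  rw [Finset.sum_comm, Finset.mul_sum]
  refine Finset.sum_congr rfl fun i hi => ?_
  rw [Finset.sum_comm, Finset.mul_sum]
  refine Finset.sum_congr rfl fun h hh => ?_
  rw [← Finset.mul_sum, sum_separates_rotate S (Finset.mem_range.1 hi) (Finset.mem_range.1 hh)]
  ring

/-- Jensen's inequality for exp bounds each term by the average over `b` of the rotated terms; for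
fixed `b`, rotation only permutes the subsets, so the node-by-node bound applies. -/
theorem sum_exp_neg_le_of_backwardEnergy {B : ℕ → ℕ → ℝ} (hB0 : ∀ i h, 0 ≤ B i h)
    (hB1 : ∀ i, 1 ≤ i → ∑ h ∈ Finset.range i, B i h = 1) {l : ℝ} (hl : 0 ≤ l)
    (f : Finset (Fin n) → ℝ)
    (hf : ∀ S, ∑ b, backwardEnergy B n (rotate b S) ≤ n * f S) :
    ∑ S, Real.exp (-(l * f S)) ≤ 2 * (1 + Real.exp (-l)) ^ (n - 1) := by
  have hn : (0 : ℝ) < n := by exact_mod_cast NeZero.pos n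
  have h1 : ∀ S : Finset (Fin n), Real.exp (-(l * f S)) ≤
      ∑ b : Fin n, (1 / n : ℝ) * Real.exp (-(l * backwardEnergy B n (rotate b S))) := by
    intro S
    have hJ := convexOn_exp.map_sum_le (t := Finset.univ) (w := fun _ : Fin n => (1 / n : ℝ))
      (p := fun b => -(l * backwardEnergy B n (rotate b S))) (fun _ _ => by positivity)
      (by simp [hn.ne']) (fun _ _ => Set.mem_univ _)
    simp only [smul_eq_mul] at hJ
    refine le_trans (Real.exp_le_exp.2 ?_) hJ
    rw [← Finset.mul_sum, Finset.sum_neg_distrib, ← Finset.mul_sum, mul_neg, neg_le_neg_iff,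
      one_div, inv_mul_le_iff₀ hn]
    nlinarith [mul_le_mul_of_nonneg_left (hf S) hl]
  refine (Finset.sum_le_sum fun S _ => h1 S).trans ?_
  rw [Finset.sum_comm]
  simp only [← Finset.mul_sum]
  have h2 : ∀ b : Fin n, ∑ S, Real.exp (-(l * backwardEnergy B n (rotate b S))) ≤
      2 * (1 + Real.exp (-l)) ^ (n - 1) := by
    intro b
    rw [sum_rotate b fun T => Real.exp (-(l * backwardEnergy B n T))]
    have := sum_powerset_exp_backwardEnergy_le hB0 hB1 hl (n - 1)
    rwa [Nat.sub_add_cancel (NeZero.pos n)] at this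
  rw [one_div, inv_mul_le_iff₀ hn]
  refine (Finset.sum_le_sum fun b _ => h2 b).trans ?_
  simp

/-- Each node is joined to the first one. -/
def starKernel (i h : ℕ) : ℝ := if h + 1 = i then 1 else 0

/-- Each of the first `r` nodes is joined to the first one, every other node with equal weights to
its `r` predecessors. -/
noncomputable def latticeKernel (r i h : ℕ) : ℝ :=
  if i < r then starKernel i h else if h < r then 1 / r else 0

theorem sum_starKernel_mul {i : ℕ} (hi : 1 ≤ i) (g : ℕ → ℝ) :
    ∑ h ∈ Finset.range i, starKernel i h * g (h + 1) = g i := by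
  obtain ⟨m, rfl⟩ := Nat.exists_eq_add_of_le' hi
  rw [Finset.sum_eq_single m]
  · simp [starKernel]
  · intro h _ hne
    simp [starKernel, hne]
  · simp

theorem sum_latticeKernel_mul {r i : ℕ} (hi : r ≤ i) (g : ℕ → ℝ) :
    ∑ h ∈ Finset.range i, latticeKernel r i h * g (h + 1) =
      1 / r * ∑ h ∈ Finset.range r, g (h + 1) := by
  rw [Finset.mul_sum]
  symm
  refine Finset.sum_subset_zero_on_sdiff (Finset.range_subset_range.2 hi) ?_ ?_
  · intro h hh
    simp only [Finset.mem_sdiff, Finset.mem_range] at hh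
    simp [latticeKernel, not_lt.2 hi, hh.2]
  · intro h hh
    rw [Finset.mem_range] at hh
    simp [latticeKernel, not_lt.2 hi, hh]

theorem sum_latticeKernel {r i : ℕ} (hr : 0 < r) (hi : 1 ≤ i) :
    ∑ h ∈ Finset.range i, latticeKernel r i h = 1 := by
  rcases lt_or_ge i r with h | h
  · simpa [latticeKernel, h] using sum_starKernel_mul hi fun _ => 1
  · have := sum_latticeKernel_mul h fun _ => 1
    have hr' : (r : ℝ) ≠ 0 := by positivity
    simpa [hr'] using this

theorem sum_sum_starKernel_mul (n : ℕ) (g : ℕ → ℝ) (hg : g 0 = 0) :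
    ∑ i ∈ Finset.range n, ∑ h ∈ Finset.range i, starKernel i h * g (h + 1) =
      ∑ i ∈ Finset.range n, g i := by
  refine Finset.sum_congr rfl fun i _ => ?_
  rcases Nat.eq_zero_or_pos i with rfl | hi
  · simp [hg]
  · exact sum_starKernel_mul hi g

/-- The first r nodes contribute g(0) + ... + g(r - 1), at most the sum over one window g(1), ...,
g(r); each of the other n - r nodes contributes 1/r of that window. -/
theorem sum_sum_latticeKernel_mul_le {r n : ℕ} (hr : 0 < r) (hrn : r ≤ n) (g : ℕ → ℝ)
    (hg0 : g 0 = 0) (hg : ∀ i, 0 ≤ g i) :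
    ∑ i ∈ Finset.range n, ∑ h ∈ Finset.range i, latticeKernel r i h * g (h + 1) ≤
      n / r * ∑ h ∈ Finset.range r, g (h + 1) := by
  have hr' : (0 : ℝ) < r := by exact_mod_cast hr
  rw [Finset.range_eq_Ico, ← Finset.sum_Ico_consecutive _ (Nat.zero_le r) hrn, ← Finset.range_eq_Ico]
  have h1 : ∑ i ∈ Finset.range r, ∑ h ∈ Finset.range i, latticeKernel r i h * g (h + 1) ≤
      ∑ h ∈ Finset.range r, g (h + 1) := by
    have e : ∑ i ∈ Finset.range r, ∑ h ∈ Finset.range i, latticeKernel r i h * g (h + 1) =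
        ∑ i ∈ Finset.range r, ∑ h ∈ Finset.range i, starKernel i h * g (h + 1) := by
      refine Finset.sum_congr rfl fun i hi => Finset.sum_congr rfl fun h _ => ?_
      simp [latticeKernel, Finset.mem_range.1 hi]
    rw [e, sum_sum_starKernel_mul r g hg0]
    have := Finset.sum_range_succ' g r
    rw [Finset.sum_range_succ, hg0] at this
    linarith [hg r]
  have h2 : ∑ i ∈ Finset.Ico r n, ∑ h ∈ Finset.range i, latticeKernel r i h * g (h + 1) =
      (n - r) * (1 / r * ∑ h ∈ Finset.range r, g (h + 1)) := by
    rw [Finset.sum_congr rfl fun i hi => sum_latticeKernel_mul (Finset.mem_Ico.1 hi).1 g]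
    simp [Nat.cast_sub hrn]
  rw [h2]
  refine (add_le_add_left h1 _).trans (le_of_eq ?_)
  field_simp
  ring

theorem starKernel_nonneg (i h : ℕ) : 0 ≤ starKernel i h := by
  unfold starKernel
  split_ifs <;> norm_num

theorem latticeKernel_nonneg (r i h : ℕ) : 0 ≤ latticeKernel r i h := by
  unfold latticeKernel
  split_ifs
  · exact starKernel_nonneg i h
  · positivity
  · exact le_rfl

/-- The kernel mixes the lattice and star kernels in the proportions in which 2r(1 - p) and p(n - 1)
make up c_w. After averaging, the first yields the lattice part of the cut and the second the
complete-graph part, the latter with a factor n - 1 that is relaxed to n. -/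
theorem sum_exp_neg_cutValue_le {r : ℕ} (hr : 2 * r < n) (p : unitInterval)
    (hc : 0 < cw n (2 * r) p) {l : ℝ} (hl : 0 ≤ l) :
    ∑ S, Real.exp (-(l * (2 * cutValue (edgeProb n (2 * r) p) S / cw n (2 * r) p))) ≤
      2 * (1 + Real.exp (-l)) ^ (n - 1) := by
  set c := cw n (2 * r) p with hcdef
  have hcw : c = 2 * r * (1 - p) + p * (n - 1) := by
    rw [hcdef, cw]
    push_cast
    ring
  have hp0 : 0 ≤ (p : ℝ) := p.2.1
  have hp1 : 0 ≤ 1 - (p : ℝ) := sub_nonneg.2 p.2.2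
  have hn1 : (1 : ℝ) ≤ n := by exact_mod_cast NeZero.pos n
  set t : ℝ := 2 * r * (1 - p) / c with ht
  have ht1 : 1 - t = p * (n - 1) / c := by
    rw [ht, eq_div_iff hc.ne', sub_mul, div_mul_cancel₀ _ hc.ne']
    linarith
  have ht0 : 0 ≤ t := by positivity
  have ht1' : 0 ≤ 1 - t := by
    rw [ht1]
    exact div_nonneg (mul_nonneg hp0 (by linarith)) hc.le
  refine sum_exp_neg_le_of_backwardEnergy
    (B := fun i h => t * latticeKernel r i h + (1 - t) * starKernel i h) ?_ ?_ hl _ ?_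
  · intro i h
    exact add_nonneg (mul_nonneg ht0 (latticeKernel_nonneg r i h))
      (mul_nonneg ht1' (starKernel_nonneg i h))
  · intro i hi
    rw [Finset.sum_add_distrib, ← Finset.mul_sum, ← Finset.mul_sum]
    have hs : ∑ h ∈ Finset.range i, starKernel i h = 1 := by
      simpa using sum_starKernel_mul hi fun _ => 1
    rw [hs]
    -- For r = 0 the lattice kernel vanishes instead of summing to 1, but then t = 0.
    rcases Nat.eq_zero_or_pos r with rfl | hr0
    · simp [ht]
    · rw [sum_latticeKernel hr0 hi]
      ring
  · intro S
    set g : ℕ → ℝ := fun m => (crossCount S (m : Fin n) : ℝ) with hg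
    have hg0 : g 0 = 0 := by simp [hg, crossCount_zero]
    have hgn : ∀ i, 0 ≤ g i := fun i => Nat.cast_nonneg _
    rw [sum_backwardEnergy_rotate, cutValue_edgeProb hr]
    change 2 * ∑ i ∈ Finset.range n, ∑ h ∈ Finset.range i,
      (t * latticeKernel r i h + (1 - t) * starKernel i h) * g (h + 1) ≤
        n * (2 * ((1 - (p : ℝ)) * (2 * ∑ h ∈ Finset.range r, g (h + 1)) + _) / c)
    have hK : ∑ i ∈ Finset.range n, g i = S.card * Sᶜ.card := by
      rw [← Fin.sum_univ_eq_sum_range]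
      simp only [hg, Fin.cast_val_eq_self]
      exact_mod_cast sum_crossCount S
    rw [← hK]
    set M := ∑ h ∈ Finset.range r, g (h + 1)
    have hstar := sum_sum_starKernel_mul n g hg0
    have hlat : t * ∑ i ∈ Finset.range n, ∑ h ∈ Finset.range i, latticeKernel r i h * g (h + 1) ≤
        2 * (1 - p) * n * M / c := by
      rcases Nat.eq_zero_or_pos r with rfl | hr0
      · simp [ht, M]
      · refine (mul_le_mul_of_nonneg_left
          (sum_sum_latticeKernel_mul_le hr0 (by omega) g hg0 hgn) ht0).trans (le_of_eq ?_)
        have : (r : ℝ) ≠ 0 := by positivity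
        rw [ht]
        field_simp
        ring
    have hstar' : (1 - t) * ∑ i ∈ Finset.range n, g i ≤ p * n * (∑ i ∈ Finset.range n, g i) / c := by
      rw [ht1, div_mul_eq_mul_div]
      have : 0 ≤ ∑ i ∈ Finset.range n, g i := Finset.sum_nonneg fun i _ => hgn i
      refine div_le_div_of_nonneg_right (mul_le_mul_of_nonneg_right
        (mul_le_mul_of_nonneg_left ?_ hp0) this) hc.le
      linarith
    simp only [add_mul, Finset.sum_add_distrib, mul_assoc, ← Finset.mul_sum]
    rw [hstar]
    simp only [mul_assoc] at hlat hstar'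
    refine (mul_le_mul_of_nonneg_left (add_le_add hlat hstar') zero_le_two).trans (le_of_eq ?_)
    ring

/-- With l = ln n the bound becomes 2(1 + 1/n)^{n-1} ≤ 2e < 6. -/
theorem sum_exp_neg_log_cutValue_le {r : ℕ} (hr : 2 * r < n) (p : unitInterval)
    (hc : 0 < cw n (2 * r) p) :
    ∑ S, Real.exp (-(Real.log n * (2 * cutValue (edgeProb n (2 * r) p) S / cw n (2 * r) p))) ≤
      6 := by
  have hn1 : (1 : ℝ) ≤ n := by exact_mod_cast NeZero.pos n
  refine (sum_exp_neg_cutValue_le hr p hc (Real.log_nonneg hn1)).trans ?_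
  have h1 : Real.exp (-Real.log n) = 1 / n := by
    rw [Real.exp_neg, Real.exp_log (by linarith), one_div]
  have h2 : (1 + 1 / (n : ℝ)) ^ (n - 1) ≤ Real.exp 1 := by
    calc (1 + 1 / (n : ℝ)) ^ (n - 1) ≤ Real.exp (1 / n) ^ (n - 1) := by
          refine pow_le_pow_left₀ (by positivity) ?_ _
          linarith [Real.add_one_le_exp (1 / (n : ℝ))]
      _ = Real.exp ((n - 1 : ℕ) * (1 / n)) := by rw [← Real.exp_nat_mul]
      _ ≤ Real.exp 1 := by
          refine Real.exp_le_exp.2 ?_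
          rw [mul_one_div, div_le_one (by linarith)]
          exact_mod_cast Nat.sub_le n 1
  rw [h1]
  linarith [Real.exp_one_lt_d9]

end Rotation

/-! ### Cuts as sets of unordered pairs. -/

theorem edgeInd_nonneg {V : Type*} (G : SimpleGraph V) (e : Sym2 V) : 0 ≤ edgeInd G e := by
  unfold edgeInd
  split_ifs <;> norm_num

theorem one_le_sum_edgeInd {V : Type*} {G : SimpleGraph V} {B : Finset (Sym2 V)}
    (h : 0 < ∑ e ∈ B, edgeInd G e) : 1 ≤ ∑ e ∈ B, edgeInd G e := by
  unfold edgeInd at *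
  rw [Finset.sum_boole] at *
  exact_mod_cast h

section Cuts

variable {V : Type*} [Fintype V] [DecidableEq V]

/-- The unordered pairs with one node in `S` and the other outside `S`. -/
def cutPairs (S : Finset V) : Finset (Sym2 V) := (S ×ˢ Sᶜ).image fun x => s(x.1, x.2)

theorem not_isDiag_of_mem_cutPairs {S : Finset V} : ∀ e ∈ cutPairs S, ¬ e.IsDiag := by
  intro e he
  obtain ⟨⟨i, j⟩, hij, rfl⟩ := Finset.mem_image.1 he
  rw [Finset.mem_product, Finset.mem_compl] at hij
  rw [Sym2.mk_isDiag_iff]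
  exact fun h => hij.2 (h ▸ hij.1)

theorem sum_cutPairs (S : Finset V) (f : Sym2 V → ℝ) :
    ∑ e ∈ cutPairs S, f e = ∑ i ∈ S, ∑ j ∈ Sᶜ, f s(i, j) := by
  rw [cutPairs, Finset.sum_image, Finset.sum_product]
  rintro ⟨a, b⟩ hab ⟨a', b'⟩ hab' h
  simp only [Finset.coe_product, Set.mem_prod, Finset.mem_coe, Finset.mem_compl] at hab hab'
  rcases Sym2.eq_iff.1 h with ⟨h1, h2⟩ | ⟨h1, h2⟩
  · exact Prod.ext h1 h2
  · exact absurd ((show a = b' from h1) ▸ hab.1) hab'.2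

/-- Weighted handshake lemma: the pairs cut off by {v} are those containing v, and each pair has two
ends. -/
theorem sum_sum_compl_singleton {n : ℕ} (f : Sym2 (Fin n) → ℝ) :
    ∑ v, ∑ e ∈ cutPairs {v}, f e =
      2 * ∑ e ∈ Finset.univ.filter (fun e : Sym2 (Fin n) => ¬ e.IsDiag), f e := by
  have h1 : ∑ v, ∑ e ∈ cutPairs {v}, f e =
      ∑ x ∈ (Finset.univ : Finset (Fin n)).offDiag, f s(x.1, x.2) := by
    simp only [sum_cutPairs, Finset.sum_singleton]
    rw [Finset.sum_sigma', eq_comm]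
    refine Finset.sum_bij' (fun x _ => ⟨x.1, x.2⟩) (fun x _ => (x.1, x.2)) ?_ ?_ ?_ ?_ ?_ <;>
      simp [eq_comm]
  have h2 := Finset.sum_sym2_filter_not_isDiag (Finset.univ : Finset (Fin n)) f
  rw [Finset.sym2_univ] at h2
  rw [h1, h2, two_mul, ← Finset.sum_filter_add_sum_filter_not _ (fun x : Fin n × Fin n => x.1 < x.2)]
  congr 1
  refine Finset.sum_bij' (fun x _ => x.swap) (fun x _ => x.swap) ?_ ?_ ?_ ?_ ?_
  · rintro ⟨a, b⟩ hx
    simp only [Finset.mem_filter, Finset.mem_offDiag, Finset.mem_univ, true_and, not_lt,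
      Prod.swap] at hx ⊢
    exact ⟨Ne.symm hx.1, lt_of_le_of_ne hx.2 (Ne.symm hx.1)⟩
  · rintro ⟨a, b⟩ hx
    simp only [Finset.mem_filter, Finset.mem_offDiag, Finset.mem_univ, true_and, not_lt,
      Prod.swap] at hx ⊢
    exact ⟨Ne.symm hx.1, hx.2.le⟩
  · simp
  · simp
  · rintro ⟨a, b⟩ _
    simp [Sym2.eq_swap]

theorem capacity_eq (G : SimpleGraph V) :
    capacity G = sInf {x : ℝ | ∃ S : Finset V, S.Nonempty ∧ Sᶜ.Nonempty ∧
      x = ∑ e ∈ cutPairs S, edgeInd G e} := by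
  unfold capacity weightedCapacity cutValue
  simp only [sum_cutPairs]
  congr! 8

theorem capacity_le (G : SimpleGraph V) {S : Finset V} (hS : S.Nonempty) (hSc : Sᶜ.Nonempty) :
    capacity G ≤ ∑ e ∈ cutPairs S, edgeInd G e := by
  rw [capacity_eq]
  refine csInf_le ⟨0, ?_⟩ ⟨S, hS, hSc, rfl⟩
  rintro x ⟨T, -, -, rfl⟩
  exact Finset.sum_nonneg fun e _ => edgeInd_nonneg G e

theorem exists_lt_of_capacity_lt (G : SimpleGraph V) (hV : 2 ≤ Fintype.card V) {a : ℝ}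
    (h : capacity G < a) :
    ∃ S : Finset V, S.Nonempty ∧ Sᶜ.Nonempty ∧ ∑ e ∈ cutPairs S, edgeInd G e < a := by
  rw [capacity_eq] at h
  obtain ⟨v⟩ : Nonempty V := Fintype.card_pos_iff.1 (by omega)
  have hne : ({v} : Finset V)ᶜ.Nonempty := by
    rw [← Finset.card_pos, Finset.card_compl, Finset.card_singleton]
    omega
  obtain ⟨x, ⟨S, hS, hSc, rfl⟩, hx⟩ :=
    exists_lt_of_csInf_lt (by exact ⟨_, {v}, Finset.singleton_nonempty v, hne, rfl⟩) h
  exact ⟨S, hS, hSc, hx⟩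

end Cuts

theorem sum_cutPairs_pairWeight (n k : ℕ) (p : unitInterval) (S : Finset (Fin n)) :
    ∑ e ∈ cutPairs S, pairWeight n k p e = cutValue (edgeProb n k p) S := by
  rw [sum_cutPairs, cutValue]
  refine Finset.sum_congr rfl fun i hi => Finset.sum_congr rfl fun j hj => ?_
  rw [edgeProb_eq_pairWeight]
  rintro rfl
  exact Finset.mem_compl.1 hj hi

/-! ### Lower tail of the capacity. -/

/-- Multiply by exp(x) ≥ 1 + x + x²/2 and use (1 + x²/2)² - x² = 1 + x⁴/4 ≥ 1. -/
theorem exp_neg_le_quadratic {x : ℝ} (hx : 0 ≤ x) : Real.exp (-x) ≤ 1 - x + x ^ 2 / 2 := by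
  rw [Real.exp_neg, inv_le_iff_one_le_mul₀ (Real.exp_pos x)]
  have h1 := Real.quadratic_le_exp_of_nonneg hx
  have h2 : 0 < 1 - x + x ^ 2 / 2 := by nlinarith [sq_nonneg (x - 1)]
  calc (1 : ℝ) ≤ (1 - x + x ^ 2 / 2) * (1 + x + x ^ 2 / 2) := by nlinarith [sq_nonneg (x ^ 2)]
    _ ≤ _ := mul_le_mul_of_nonneg_left h1 h2.le

/-- Chernoff bound with θ = -x: the exponent is at most (-x + x²/2)w + x(1 - x)w = -x²w/2. -/
theorem measure_cut_lt_le (n k : ℕ) (p : unitInterval) (S : Finset (Fin n)) {x : ℝ} (hx : 0 ≤ x) :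
    (smallWorld n k p).real {G | ∑ e ∈ cutPairs S, edgeInd G e <
        (1 - x) * cutValue (edgeProb n k p) S} ≤
      Real.exp (-(x ^ 2 * cutValue (edgeProb n k p) S / 2)) := by
  have h := measure_exp_markov n k p (cutPairs S) not_isDiag_of_mem_cutPairs (-x)
    (-x * ((1 - x) * cutValue (edgeProb n k p) S))
  rw [sum_cutPairs_pairWeight] at h
  have hw : 0 ≤ cutValue (edgeProb n k p) S := by
    rw [← sum_cutPairs_pairWeight]
    exact Finset.sum_nonneg fun e _ => pairWeight_nonneg n k p e
  refine (measureReal_mono ?_).trans (h.trans (Real.exp_le_exp.2 ?_))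
  · intro G hG
    exact mul_le_mul_of_nonpos_left (le_of_lt hG) (neg_nonpos.2 hx)
  · nlinarith [mul_le_mul_of_nonneg_right (exp_neg_le_quadratic hx) hw]

theorem measure_capacity_lt_le {n k : ℕ} {p : unitInterval} {d : ℝ} (hd : 0 < d) (hn : 2 ≤ n)
    (hk : Even k) (hkn : k < n) (hc : 0 < cw n k p) :
    (smallWorld n k p).real {G | capacity G < (1 - eps d n k p) * cw n k p} ≤
      6 * Real.exp (-(d * Real.log n)) := by
  have : NeZero n := ⟨by omega⟩
  obtain ⟨r, rfl⟩ := hk.exists_two_nsmul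
  rw [smul_eq_mul] at *
  set c := cw n (2 * r) p with hcdef
  set x := eps d n (2 * r) p with hx
  have hlog : 0 ≤ Real.log n := Real.log_nonneg (by exact_mod_cast (by omega : 1 ≤ n))
  have hx0 : 0 ≤ x := Real.sqrt_nonneg _
  have hx2 : x ^ 2 = 2 * (d + 2) * Real.log n / c :=
    Real.sq_sqrt (div_nonneg (by positivity) hc.le)
  -- For x > 1 the threshold is negative and the event is empty. Otherwise 1 - x ≥ 0, which allows c
  -- to be replaced by the larger w(S) in the union bound.
  rcases lt_or_ge 1 x with h1 | h1
  · have hempty : {G : SimpleGraph (Fin n) | capacity G < (1 - x) * c} = ∅ := by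
      refine Set.eq_empty_of_forall_notMem fun G hG => ?_
      obtain ⟨S, -, -, hS⟩ := exists_lt_of_capacity_lt G (by simpa using hn) hG
      have h2 : 0 ≤ ∑ e ∈ cutPairs S, edgeInd G e :=
        Finset.sum_nonneg fun e _ => edgeInd_nonneg G e
      nlinarith
    rw [hempty, measureReal_empty]
    positivity
  set w : Finset (Fin n) → ℝ := cutValue (edgeProb n (2 * r) p) with hw
  set 𝒮 : Finset (Finset (Fin n)) := Finset.univ.filter fun S => S.Nonempty ∧ Sᶜ.Nonempty with h𝒮
  have hcw : ∀ S ∈ 𝒮, c ≤ w S := by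
    intro S hS
    rw [Finset.mem_filter] at hS
    exact cw_le_cutValue hkn p hS.2.1 hS.2.2
  have hsub : {G : SimpleGraph (Fin n) | capacity G < (1 - x) * c} ⊆
      ⋃ S ∈ 𝒮, {G | ∑ e ∈ cutPairs S, edgeInd G e < (1 - x) * w S} := by
    intro G hG
    obtain ⟨S, hS, hSc, hlt⟩ := exists_lt_of_capacity_lt G (by simpa using hn) hG
    have hmem : S ∈ 𝒮 := Finset.mem_filter.2 ⟨Finset.mem_univ S, hS, hSc⟩
    refine Set.mem_biUnion hmem (hlt.trans_le ?_)
    exact mul_le_mul_of_nonneg_left (hcw S hmem) (by linarith)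
  calc (smallWorld n (2 * r) p).real {G | capacity G < (1 - x) * c}
      ≤ ∑ S ∈ 𝒮, (smallWorld n (2 * r) p).real
          {G | ∑ e ∈ cutPairs S, edgeInd G e < (1 - x) * w S} :=
        (measureReal_mono hsub (measure_ne_top _ _)).trans (measureReal_biUnion_finset_le _ _)
    _ ≤ ∑ S ∈ 𝒮, Real.exp (-(d * Real.log n)) * Real.exp (-(Real.log n * (2 * w S / c))) := by
        refine Finset.sum_le_sum fun S hS => (measure_cut_lt_le _ _ p S hx0).trans ?_
        rw [← Real.exp_add, Real.exp_le_exp, hx2]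
        -- Since w/c ≥ 1, (d + 2)w/c ≥ d + 2w/c: the d gives the factor n^{-d}, the 2w/c feeds the
        -- partition function.
        have h2 : 1 ≤ w S / c := (one_le_div hc).2 (hcw S hS)
        have h3 : 2 * (d + 2) * Real.log n / c * w S / 2 =
          (d + 2) * Real.log n * (w S / c) := by ring
        rw [← hw, h3, mul_div_assoc]
        nlinarith [mul_le_mul_of_nonneg_left h2 (mul_nonneg hd.le hlog)]
    _ ≤ ∑ S, Real.exp (-(d * Real.log n)) * Real.exp (-(Real.log n * (2 * w S / c))) :=
        Finset.sum_le_sum_of_subset_of_nonneg (Finset.subset_univ _) fun _ _ _ => by positivity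
    _ ≤ 6 * Real.exp (-(d * Real.log n)) := by
        rw [← Finset.mul_sum, mul_comm]
        exact mul_le_mul_of_nonneg_right (sum_exp_neg_log_cutValue_le hkn p hc)
          (Real.exp_pos _).le

/-! ### Upper tail of the capacity. -/

theorem measure_lt_capacity_le {n k : ℕ} {p : unitInterval} {d : ℝ} (hd : 0 < d) (hn : 4 ≤ n)
    (hk : Even k) (hkn : k < n) (hc : 0 < cw n k p) (hnd : 8 * d * Real.log n ≤ n) :
    (smallWorld n k p).real {G | (1 + eps d n k p) * cw n k p < capacity G} ≤
      Real.exp (1 - d * Real.log n) := by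
  have : NeZero n := ⟨by omega⟩
  obtain ⟨r, rfl⟩ := hk.exists_two_nsmul
  rw [smul_eq_mul] at *
  set c := cw n (2 * r) p with hcdef
  set x := eps d n (2 * r) p with hx
  have hn4 : (4 : ℝ) ≤ n := by exact_mod_cast hn
  have hlog : 0 ≤ Real.log n := Real.log_nonneg (by linarith)
  have hx0 : 0 ≤ x := Real.sqrt_nonneg _
  have hx2 : x ^ 2 * c = 2 * (d + 2) * Real.log n := by
    rw [hx, eps, Real.sq_sqrt (div_nonneg (by positivity) hc.le), div_mul_cancel₀ _ hc.ne']
  set B := Finset.univ.filter fun e : Sym2 (Fin n) => ¬ e.IsDiag with hB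
  have hBd : ∀ e ∈ B, ¬ e.IsDiag := fun e he => (Finset.mem_filter.1 he).2
  set μ := ∑ e ∈ B, pairWeight n (2 * r) p e with hμdef
  have hμ : 2 * μ = n * c := by
    rw [hμdef, hB, ← sum_sum_compl_singleton]
    simp [sum_cutPairs_pairWeight, cutValue_edgeProb_singleton hkn, hcdef]
  have hμ0 : 0 < μ := by nlinarith
  have hdeg : ∀ (G : SimpleGraph (Fin n)) v, capacity G ≤ ∑ e ∈ cutPairs {v}, edgeInd G e := by
    intro G v
    refine capacity_le G (Finset.singleton_nonempty v) ?_
    rw [← Finset.card_pos, Finset.card_compl, Finset.card_singleton, Fintype.card_fin]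
    omega
  have hE : ∀ (G : SimpleGraph (Fin n)) (a : ℝ),
      (∀ v, a ≤ ∑ e ∈ cutPairs {v}, edgeInd G e) → n * a ≤ 2 * ∑ e ∈ B, edgeInd G e := by
    intro G a ha
    rw [hB, ← sum_sum_compl_singleton]
    simpa using Finset.sum_le_sum fun v (_ : v ∈ Finset.univ) => ha v
  have hE1 : ∀ G ∈ {G : SimpleGraph (Fin n) | (1 + x) * c < capacity G},
      (1 + x) * μ ≤ ∑ e ∈ B, edgeInd G e := by
    intro G hG
    have := hE G ((1 + x) * c) fun v => (le_of_lt hG).trans (hdeg G v)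
    nlinarith
  have hE2 : ∀ G ∈ {G : SimpleGraph (Fin n) | (1 + x) * c < capacity G},
      (n : ℝ) / 2 ≤ ∑ e ∈ B, edgeInd G e := by
    intro G hG
    have hpos : 0 < (1 + x) * c := by positivity
    have := hE G 1 fun v => one_le_sum_edgeInd ((hpos.trans hG).trans_le (hdeg G v))
    linarith
  have he : Real.exp 1 ≤ 3 := by linarith [Real.exp_one_lt_d9]
  have hdl : 0 ≤ d * Real.log n := mul_nonneg hd.le hlog
  -- For x ≤ 2 take θ = x/2 and e^θ - 1 ≤ θ + θ²: the exponent is at most -x²μ/4 = -n(d + 2)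
  -- ln(n)/4, and n ≥ 4 suffices.
  rcases le_or_gt x 2 with h1 | h1
  · have h := measure_exp_markov n (2 * r) p B hBd (x / 2) (x / 2 * ((1 + x) * μ))
    refine (measureReal_mono fun G hG => ?_).trans (h.trans (Real.exp_le_exp.2 ?_))
    · exact mul_le_mul_of_nonneg_left (hE1 G hG) (by linarith)
    · have h2 := (abs_le.1 (Real.abs_exp_sub_one_sub_id_le
        (show |x / 2| ≤ 1 by rw [abs_of_nonneg (by linarith)]; linarith))).2
      have h3 := mul_le_mul_of_nonneg_right h2 hμ0.le
      have h4 : x ^ 2 * μ = n * ((d + 2) * Real.log n) := by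
        linear_combination (x ^ 2 / 2) * hμ + (n / 2 : ℝ) * hx2
      have h5 : 4 * ((d + 2) * Real.log n) ≤ n * ((d + 2) * Real.log n) :=
        mul_le_mul_of_nonneg_right hn4 (by positivity)
      rw [← hμdef]
      nlinarith
  -- For x > 2 take θ = 1. As e ≤ 3, the exponent is at most (1 - x)μ ≤ -xμ/2 = -n·x·c/4, which is
  -- at most -d ln n when nc ≥ 1.
  rcases le_or_gt 1 ((n : ℝ) * c) with h2 | h2
  · have h := measure_exp_markov n (2 * r) p B hBd 1 ((1 + x) * μ)
    refine (measureReal_mono fun G hG => ?_).trans (h.trans (Real.exp_le_exp.2 ?_))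
    · simpa using hE1 G hG
    · have h3 : 4 * (d * Real.log n) ≤ n * (x * c) := by
        -- Squaring brings in x²c, which is known exactly.
        rw [← sq_le_sq₀ (by positivity) (by positivity)]
        calc (4 * (d * Real.log n)) ^ 2 = 2 * d * Real.log n * (8 * d * Real.log n) := by ring
          _ ≤ 2 * d * Real.log n * n := mul_le_mul_of_nonneg_left hnd (by positivity)
          _ ≤ 2 * (d + 2) * Real.log n * n * (n * c) := by
            have : 2 * d * Real.log n * n ≤ 2 * (d + 2) * Real.log n * n := by
              have : 0 ≤ Real.log n * n := by positivity
              nlinarith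
            exact this.trans (le_mul_of_one_le_right (by positivity) h2)
          _ = (n * (x * c)) ^ 2 := by
            linear_combination (-(n ^ 2 * c) : ℝ) * hx2
      have h4 : n * (x * c) = 2 * (x * μ) := by linear_combination -x * hμ
      have h5 : 2 * μ ≤ x * μ := mul_le_mul_of_nonneg_right h1.le hμ0.le
      have h6 := mul_le_mul_of_nonneg_right he hμ0.le
      rw [← hμdef]
      linarith
  -- Very sparse case nc < 1: integrality is used instead. Positive capacity makes every degree at
  -- least 1, hence there are at least n/2 edges, against an expected number μ < 1/2.
  · have h := measure_exp_markov n (2 * r) p B hBd 1 (n / 2)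
    refine (measureReal_mono fun G hG => ?_).trans (h.trans (Real.exp_le_exp.2 ?_))
    · simpa using hE2 G hG
    · have h6 := mul_le_mul_of_nonneg_right he hμ0.le
      rw [← hμdef]
      linarith

/-! ### Combining the tails and choosing the constant. -/

theorem two_le_of_cw_pos {n k : ℕ} {p : unitInterval} (hkn : k < n) (hc : 0 < cw n k p) :
    2 ≤ n := by
  by_contra hn
  obtain rfl : n = 1 := by omega
  obtain rfl : k = 0 := by omega
  simp [cw] at hc

/-- The constant 10 is 6 from the lower tail plus 4 ≥ e from the upper tail. -/
theorem one_sub_le_measure_capacity_mem_Icc {n k : ℕ} {p : unitInterval} {d : ℝ} (hd : 0 < d)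
    (hn : 4 ≤ n) (hk : Even k) (hkn : k < n) (hc : 0 < cw n k p)
    (hnd : 8 * d * Real.log n ≤ n) :
    1 - 10 / (n : ℝ) ^ d ≤ (smallWorld n k p).real {G | capacity G ∈
      Set.Icc ((1 - eps d n k p) * cw n k p) ((1 + eps d n k p) * cw n k p)} := by
  have h1 := measure_capacity_lt_le hd (by omega) hk hkn hc
  have h2 := measure_lt_capacity_le hd hn hk hkn hc hnd
  have hn0 : (0 : ℝ) < n := by exact_mod_cast (by omega : 0 < n)
  have h3 : Real.exp (-(d * Real.log n)) = 1 / (n : ℝ) ^ d := by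
    rw [Real.exp_neg, Real.rpow_def_of_pos hn0, mul_comm, one_div]
  rw [h3] at h1
  rw [sub_eq_add_neg, Real.exp_add, h3] at h2
  have h4 : Real.exp 1 * (1 / (n : ℝ) ^ d) ≤ 4 * (1 / (n : ℝ) ^ d) :=
    mul_le_mul_of_nonneg_right (by linarith [Real.exp_one_lt_d9]) (by positivity)
  set good := {G : SimpleGraph (Fin n) | capacity G ∈
      Set.Icc ((1 - eps d n k p) * cw n k p) ((1 + eps d n k p) * cw n k p)}
  have h5 : (smallWorld n k p).real goodᶜ ≤
      (smallWorld n k p).real {G | capacity G < (1 - eps d n k p) * cw n k p} +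
      (smallWorld n k p).real {G | (1 + eps d n k p) * cw n k p < capacity G} := by
    refine (measureReal_mono fun G hG => ?_).trans (measureReal_union_le _ _)
    by_contra hcon
    rw [Set.mem_union, not_or] at hcon
    exact hG ⟨not_lt.1 hcon.1, not_lt.1 hcon.2⟩
  rw [probReal_compl_eq_one_sub .of_discrete] at h5
  have h6 : 10 / (n : ℝ) ^ d = 6 * (1 / (n : ℝ) ^ d) + 4 * (1 / (n : ℝ) ^ d) := by ring
  linarith

theorem exists_forall_log_le (d : ℝ) : ∃ N : ℕ, ∀ n : ℕ, N ≤ n → 8 * d * Real.log n ≤ n := by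
  have h := (Real.isLittleO_log_id_atTop.const_mul_left (8 * d)).bound (c := 1) one_pos
  have h2 := (tendsto_natCast_atTop_atTop (R := ℝ)).eventually h
  obtain ⟨N, hN⟩ := Filter.eventually_atTop.1 h2
  refine ⟨N, fun n hn => ?_⟩
  have h3 := hN n hn
  simp only [id, one_mul, Real.norm_natCast] at h3
  exact (le_abs_self _).trans h3

end SmallWorld

theorem mainTheorem2 (d : ℝ) (hd : 0 < d) :
    (∀ (n k : ℕ) (p : unitInterval), 2 ≤ n → Even k → k < n →
      SmallWorld.weightedCapacity (SmallWorld.edgeProb n k p) = SmallWorld.cw n k p) ∧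
    ∃ C : ℝ, 0 < C ∧ ∀ (n k : ℕ) (p : unitInterval), Even k → k < n →
      0 < SmallWorld.cw n k p →
      1 - C / (n : ℝ) ^ d ≤
        (SmallWorld.smallWorld n k p).real
          {G | SmallWorld.capacity G ∈
            Set.Icc ((1 - SmallWorld.eps d n k p) * SmallWorld.cw n k p)
              ((1 + SmallWorld.eps d n k p) * SmallWorld.cw n k p)} := by
  refine ⟨fun n k p hn hk hkn => SmallWorld.weightedCapacity_edgeProb n k p hn hk hkn, ?_⟩
  obtain ⟨N, hN⟩ := SmallWorld.exists_forall_log_le d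
  -- The second summand makes C/n^d ≥ 1, hence the claim trivial, for the n < max N 4 to which the
  -- tail estimates may not apply.
  refine ⟨10 + ((max N 4 : ℕ) : ℝ) ^ d, by positivity, fun n k p hk hkn hc => ?_⟩
  have hn2 := SmallWorld.two_le_of_cw_pos hkn hc
  have hn0 : (0 : ℝ) < (n : ℝ) ^ d := Real.rpow_pos_of_pos (by exact_mod_cast (by omega : 0 < n)) d
  rcases le_or_gt (max N 4) n with h | h
  · refine le_trans ?_ (SmallWorld.one_sub_le_measure_capacity_mem_Icc hd
      ((le_max_right _ _).trans h) hk hkn hc (hN n ((le_max_left _ _).trans h)))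
    refine sub_le_sub_left (div_le_div_of_nonneg_right ?_ hn0.le) 1
    exact le_add_of_nonneg_right (by positivity)
  · refine le_trans ?_ measureReal_nonneg
    rw [sub_nonpos, one_le_div hn0]
    have : (n : ℝ) ^ d ≤ ((max N 4 : ℕ) : ℝ) ^ d :=
      Real.rpow_le_rpow (by positivity) (by exact_mod_cast h.le) hd.le
    linarith
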